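/- Let $\mathfrak g$ be a compact Lie algebra, i.e. a finite-dimensional real Lie algebra (for example the Lie algebra of a compact connected Lie group) with a fixed inner product $\langle\cdot,\cdot\rangle$ satisfying $\langle[x,y],z\rangle=-\langle y,[x,z]\rangle$. For a subalgebra $\mathfrak h\subset\mathfrak g$ and $x\in\mathfrak g$ put $\mathfrak h^x=\{z\in\mathfrak h:[x,z]=0\}$; let $\mathfrak z(\mathfrak h)$ be the center of $\mathfrak h$ and $\mathfrak h_s=[\mathfrak h,\mathfrak h]$ its maximal semisimple ideal. For a subalgebra $\mathfrak k\subset\mathfrak h$ and a subspace $\mathfrak m\subset\mathfrak h$ put $$q(\mathfrak m)=\min_{y\in\mathfrak m}\dim\mathfrak h^y,\quad p(\mathfrak m)=\min_{y\in\mathfrak m}\dim\mathfrak k^y,\quad r(\mathfrak m)=q(\mathfrak m)-p(\mathfrak m),$$ $$R(\mathfrak m)=\{x\in\mathfrak m:\dim\mathfrak h^x=q(\mathfrak m),\ \dim\mathfrak k^x=p(\mathfrak m)\},\qquad \mathfrak m(x)=\{y\in\mathfrak m:[x,y]\in\mathfrak m\}.$$ Let $a\in\mathfrak g$, $\mathfrak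 k=\mathfrak g^a$, and let $\mathfrak m=\mathfrak k^{\perp}$ be the orthogonal complement of $\mathfrak k$ in $\mathfrak g$. Let $x_0\in R(\mathfrak m)$, where $R(\mathfrak m)$ and $r(\mathfrak m)$ refer to the pair $(\mathfrak g,\mathfrak k)$. Let $\mathfrak g_0$ and $\mathfrak k_0$ be the centralizers of $\mathfrak k^{x_0}$ in $\mathfrak g$ and in $\mathfrak k$ respectively, and let $\mathfrak m_0=\mathfrak g_0\cap\mathfrak m$; $R(\mathfrak m_0)$ and $r(\mathfrak m_0)$ refer to the pair $(\mathfrak g_0,\mathfrak k_0)$. Then: 1. $x_0\in\mathfrak m_0\cap R(\mathfrak m)$, and $\mathfrak m_0(x)=\mathfrak m(x)$ for every $x\in\mathfrak m_0\cap R(\mathfrak m)$. 2. For every $x\in\mathfrak m_0\cap R(\mathfrak m)$ we have $\mathfrak k^x=\mathfrak k^{x_0}$ and $x\in R(\mathfrak m_0)$. 3. $a\in\mathfrak g_0$, $\mathfrak g^{x_0}=\mathfrak g_0^{x_0}\oplus(\mathfrak k^{x_0})_s$, and the sum $\mathfrak g_0+(\mathfrak k^{x_0})_s$ is direct and is a subalgebra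 of $\mathfrak g$ of maximal rank, i.e. its rank equals $\operatorname{rank}\mathfrak g$. 4. Every $x\in R(\mathfrak m_0)$ is a regular element of the Lie algebra $\mathfrak g_0$, and its centralizer $\mathfrak k_0^x$ in $\mathfrak k_0$ is the center $\mathfrak z(\mathfrak g_0)$ of $\mathfrak g_0$. 5. $r(\mathfrak m)=r(\mathfrak m_0)=\operatorname{rank}\mathfrak g_0-\dim\mathfrak z(\mathfrak g_0)$. -/

import Mathlib

namespace CompactPair

open Module

variable {𝔤 : Type*} [LieRing 𝔤] [LieAlgebra ℝ 𝔤]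

/-- An invariant inner product on the real Lie algebra `𝔤`: a symmetric, positive definite bilinear
form with `⟨[x, y], z⟩ = -⟨y, [x, z]⟩`. -/
def IsInvariantInner (B : LinearMap.BilinForm ℝ 𝔤) : Prop :=
  B.IsSymm ∧ (∀ x : 𝔤, x ≠ 0 → 0 < B x x) ∧ B.lieInvariant 𝔤

/-- The centralizer in `𝔤` of a subset `S`. -/
def centralizer (S : Set 𝔤) : LieSubalgebra ℝ 𝔤 where
  carrier := {z | ∀ s ∈ S, ⁅s, z⁆ = 0}
  zero_mem' := fun s _ => lie_zero s
  add_mem' := fun {x y} hx hy s hs => by rw [lie_add, hx s hs, hy s hs, add_zero]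
  smul_mem' := fun c x hx s hs => by rw [lie_smul, hx s hs, smul_zero]
  lie_mem' := fun {x y} hx hy s hs => by
    rw [leibniz_lie, hx s hs, hy s hs, zero_lie, lie_zero, add_zero]

/-- `𝔥^x`: the elements of the subalgebra `𝔥` that commute with `x`. -/
def cent (𝔥 : LieSubalgebra ℝ 𝔤) (x : 𝔤) : LieSubalgebra ℝ 𝔤 :=
  𝔥 ⊓ centralizer {x}

/-- The centre of the Lie algebra `𝔥`, as a subspace of the ambient algebra. -/
def centerSub (𝔥 : LieSubalgebra ℝ 𝔤) : Submodule ℝ 𝔤 :=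
  (LieAlgebra.center ℝ 𝔥).toSubmodule.map 𝔥.toSubmodule.subtype

/-- `𝔥_s = [𝔥, 𝔥]`, as a subspace of the ambient algebra; for compact `𝔥` it is the
maximal semisimple ideal of `𝔥`. -/
def semisimplePart (𝔥 : LieSubalgebra ℝ 𝔤) : Submodule ℝ 𝔤 :=
  (⁅(⊤ : LieIdeal ℝ 𝔥), (⊤ : LieIdeal ℝ 𝔥)⁆).toSubmodule.map 𝔥.toSubmodule.subtype

/-- `𝔪(x) = {y ∈ 𝔪 : [x, y] ∈ 𝔪}`. -/
def mAt (𝔪 : Submodule ℝ 𝔤) (x : 𝔤) : Submodule ℝ 𝔤 :=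
  𝔪 ⊓ 𝔪.comap (LieAlgebra.ad ℝ 𝔤 x)

/-- The minimum of `dim 𝔥^y` over `y ∈ 𝔪`. With `𝔥 = 𝔤` this is `q(𝔪)`, with `𝔥 = 𝔨` it
is `p(𝔪)`. -/
noncomputable def minCentDim (𝔥 : LieSubalgebra ℝ 𝔤) (𝔪 : Submodule ℝ 𝔤) : ℕ :=
  sInf {n : ℕ | ∃ y ∈ 𝔪, finrank ℝ (cent 𝔥 y) = n}

/-- The set `R(𝔪)` for the pair `(𝔥, 𝔨)`: the `x ∈ 𝔪` at which both `dim 𝔥^x` and `dim 𝔨^x` are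
minimal. -/
def R (𝔥 𝔨 : LieSubalgebra ℝ 𝔤) (𝔪 : Submodule ℝ 𝔤) : Set 𝔤 :=
  {x | x ∈ 𝔪 ∧ finrank ℝ (cent 𝔥 x) = minCentDim 𝔥 𝔪 ∧
    finrank ℝ (cent 𝔨 x) = minCentDim 𝔨 𝔪}

/-- The number `r(𝔪) = q(𝔪) - p(𝔪)` for the pair `(𝔥, 𝔨)`. -/
noncomputable def r (𝔥 𝔨 : LieSubalgebra ℝ 𝔤) (𝔪 : Submodule ℝ 𝔤) : ℤ :=
  (minCentDim 𝔥 𝔪 : ℤ) - (minCentDim 𝔨 𝔪 : ℤ)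

end CompactPair

/-!
Two facts about the compact Lie algebra `𝔤` carry the proof.

*Minimal kernels* (`apply_mem_range_of_finrank_ker_le`). If `dim ker A ≤ dim ker (A + tC)` for all
`t`, then `C` maps `ker A` into the range of `A`. Applied to `ad x` with `x ∈ R(𝔪)`, on `𝔤` and on
`𝔨`, and combined with the invariance of the inner product, it shows that `[𝔤^x, 𝔤^x]` is orthogonal
to `𝔪`, hence contained in `𝔨^x` (`IsInvariantInner.apply_lie_eq_zero_of_minCentDim`), and that
`𝔪(x)` commutes with `𝔨^x` (`IsInvariantInner.lie_eq_zero_of_mem_mAt`). The second fact gives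
`𝔪(x) ⊆ 𝔤₀`. The first shows that a commutator `[u, v]` in `𝔤₀^x` lies in `𝔨^{x₀}` and so
commutes with `u`; as `ad u` is skew, `[u, v] = 0`, and `𝔤₀^x` is abelian. It also makes `[𝔨^{x₀}, 𝔨^{x₀}]` split off from
`𝔤^{x₀}`, with complement `𝔤₀^{x₀}`.

*Abelian centralizers have dimension equal to the rank*
(`IsInvariantInner.finrank_cent_eq_rank`). This is Hunt's argument: maximizing `⟪g y, x⟫` over the
compact group of isometric automorphisms `g` gives `[g y, x] = 0`. So if `𝔤^x` is abelian, it
centralizes `g y`, and `dim 𝔤^x ≤ dim 𝔤^y` for every `y`. As `ad y` is semisimple, the rank is the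
minimum of `dim 𝔤^y`. Applied to `𝔤₀` this yields the regularity statement and the value of `r(𝔪)`.
Every `𝔤^x` contains an abelian centralizer `𝔤^v` (`IsInvariantInner.exists_abelian_cent_le`), so
every subalgebra that contains `𝔤^{x₀}` has maximal rank.
-/

namespace CompactPair

open Module

/-! ### Kernels of minimal dimension in a pencil of linear maps -/

/-- First-order rigidity of kernels of minimal dimension: if `ker A` is no larger than `ker (A + tC)`
for every `t`, then `C` maps `ker A` into the range of `A`. Otherwise the rank could be increased by
a small perturbation. -/
theorem apply_mem_range_of_finrank_ker_le {V W : Type*} [AddCommGroup V] [Module ℝ V]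
    [FiniteDimensional ℝ V] [AddCommGroup W] [Module ℝ W] [FiniteDimensional ℝ W]
    (A C : V →ₗ[ℝ] W)
    (h : ∀ t : ℝ, finrank ℝ (LinearMap.ker A) ≤ finrank ℝ (LinearMap.ker (A + t • C)))
    {z : V} (hz : A z = 0) : C z ∈ LinearMap.range A := by
  by_contra hC
  let b := finBasis ℝ (LinearMap.range A)
  choose u hu using fun i => (b i).2
  let e : W ≃ₗ[ℝ] (Fin (finrank ℝ W) → ℝ) := (finBasis ℝ W).equivFun
  -- `f t` consists of vectors of the range of `A + tC` for `t ≠ 0`, and `f 0` extends a basis of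
  -- the range of `A` by `C z`.
  let f : ℝ → Option (Fin (finrank ℝ (LinearMap.range A))) → W :=
    fun t o => o.elim (C z) fun i => A (u i) + t • C (u i)
  have hf0 : LinearIndependent ℝ (f 0) := by
    rw [linearIndependent_option]
    have hfi : (f 0 ∘ some) = fun i => (b i : W) := by
      funext i
      simp [f, hu]
    rw [hfi]
    refine ⟨b.linearIndependent.map' (LinearMap.range A).subtype (Submodule.ker_subtype _), ?_⟩
    intro hmem
    refine hC (Submodule.span_le.2 ?_ hmem)
    rintro _ ⟨i, rfl⟩
    exact (b i).2
  have hopen := isOpen_setOfPred_linearIndependent (𝕜 := ℝ) (E := Fin (finrank ℝ W) → ℝ)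
    (ι := Option (Fin (finrank ℝ (LinearMap.range A))))
  have hcont : Continuous fun t : ℝ => (e ∘ f t) := by
    refine continuous_pi fun o => ?_
    rcases o with _ | i
    · exact (continuous_const : Continuous fun _ : ℝ => e (C z))
    · have : (fun t : ℝ => (e ∘ f t) (some i)) = fun t => e (A (u i)) + t • e (C (u i)) := by
        funext t
        simp [f]
      rw [this]
      fun_prop
  have hev : ∀ᶠ t in nhds (0 : ℝ), LinearIndependent ℝ (e ∘ f t) :=
    hcont.continuousAt.eventually
      (hopen.mem_nhds (hf0.map' e.toLinearMap (LinearMap.ker_eq_bot.2 e.injective)))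
  obtain ⟨t, ht, ht0⟩ := ((hev.filter_mono nhdsWithin_le_nhds).and
    (self_mem_nhdsWithin (s := {(0 : ℝ)}ᶜ))).exists
  have hft : LinearIndependent ℝ (f t) := LinearIndependent.of_comp e.toLinearMap ht
  have hmem : ∀ o, f t o ∈ LinearMap.range (A + t • C) := by
    rintro (_ | i)
    · refine ⟨t⁻¹ • z, ?_⟩
      have : t ≠ 0 := ht0
      simp [f, hz, this]
    · exact ⟨u i, by simp [f]⟩
  have hcard := (LinearIndependent.of_comp (v := fun o => (⟨f t o, hmem o⟩ :
    LinearMap.range (A + t • C))) (LinearMap.range (A + t • C)).subtype hft).fintype_card_le_finrank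
  rw [Fintype.card_option, Fintype.card_fin] at hcard
  have h1 := LinearMap.finrank_range_add_finrank_ker A
  have h2 := LinearMap.finrank_range_add_finrank_ker (A + t • C)
  have := h t
  omega

/-! ### Automorphisms of a Lie bracket with invariant inner product -/

section Hunt

open scoped InnerProductSpace

variable {E : Type*} [NormedAddCommGroup E] [InnerProductSpace ℝ E] [FiniteDimensional ℝ E]

/-- Solutions of the linear equation `c' = D c` are given by the exponential of `D`. -/
theorem eq_exp_apply_of_hasDerivAt (D : E →L[ℝ] E) (c : ℝ → E)
    (hc : ∀ s, HasDerivAt c (D (c s)) s) (s : ℝ) :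
    c s = NormedSpace.exp (s • D) (c 0) := by
  have hd : ∀ s, HasDerivAt (fun s : ℝ => NormedSpace.exp ((-s) • D) (c s)) 0 s := by
    intro s
    have h1 : HasDerivAt (fun s : ℝ => NormedSpace.exp ((-s) • D))
        ((-1 : ℝ) • (NormedSpace.exp ((-s) • D) * D)) s :=
      (hasDerivAt_exp_smul_const D (-s)).scomp s (hasDerivAt_neg s)
    convert! h1.clm_apply (hc s) using 1
    simp
  have hconst := is_const_of_deriv_eq_zero (fun s => (hd s).differentiableAt)
    (fun s => (hd s).deriv) s 0
  simp only [neg_zero, zero_smul, NormedSpace.exp_zero, one_apply_eq_self] at hconst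
  let : NormedAlgebra ℚ (E →L[ℝ] E) := .restrictScalars ℚ ℝ _
  rw [← hconst, ← mul_apply_eq_comp, ← NormedSpace.exp_add_of_commute]
  · simp
  · exact ((Commute.refl D).smul_left s).smul_right (-s)

/-- Hunt's argument: for a Lie bracket `β` with invariant inner product, any `y` can be moved by an
automorphism to commute with a given `x`. The automorphism is one that maximizes `⟪g y, x⟫` over
the compact group of isometric automorphisms. -/
theorem exists_automorphism_apply_apply_eq_zero (β : E →ₗ[ℝ] E →ₗ[ℝ] E)
    (hanti : ∀ u v, β u v = -β v u)
    (hjac : ∀ u v w, β u (β v w) = β (β u v) w + β v (β u w))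
    (hinv : ∀ u v w, ⟪β u v, w⟫_ℝ = -⟪v, β u w⟫_ℝ) (x y : E) :
    ∃ g : E →ₗ[ℝ] E, Function.Bijective g ∧ (∀ u v, g (β u v) = β (g u) (g v)) ∧
      β (g y) x = 0 := by
  let βc : E →L[ℝ] E →L[ℝ] E := β.toContinuousBilinearMap
  have hβc : ∀ u v, βc u v = β u v := fun _ _ => rfl
  let S : Set (E →L[ℝ] E) := {g | (∀ u v, ⟪g u, g v⟫_ℝ = ⟪u, v⟫_ℝ) ∧
    ∀ u v, g (βc u v) = βc (g u) (g v)}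
  have hSclosed : IsClosed S := by
    simp only [S, Set.ofPred_and, Set.ofPred_forall]
    refine IsClosed.inter ?_ ?_
    · refine isClosed_iInter fun u => isClosed_iInter fun v => isClosed_eq ?_ ?_ <;> fun_prop
    · refine isClosed_iInter fun u => isClosed_iInter fun v => isClosed_eq ?_ ?_ <;> fun_prop
  have hnorm : ∀ g ∈ S, ∀ u, ‖g u‖ = ‖u‖ := by
    intro g hg u
    rw [norm_eq_sqrt_real_inner, norm_eq_sqrt_real_inner, hg.1]
  have hSbdd : Bornology.IsBounded S := by
    refine (Metric.isBounded_iff_subset_closedBall 0).2 ⟨1, fun g hg => ?_⟩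
    rw [mem_closedBall_zero_iff]
    exact g.opNorm_le_bound zero_le_one fun u => by rw [hnorm g hg, one_mul]
  have : ProperSpace (E →L[ℝ] E) := FiniteDimensional.proper ℝ _
  have hScomp : IsCompact S := Metric.isCompact_of_isClosed_isBounded hSclosed hSbdd
  obtain ⟨g, hgS, hmax⟩ := hScomp.exists_isMaxOn (f := fun g : E →L[ℝ] E => ⟪g y, x⟫_ℝ)
    ⟨1, by simp [S]⟩ (by fun_prop)
  have hinj : Function.Injective (g : E →ₗ[ℝ] E) := by
    refine (injective_iff_map_eq_zero _).2 fun u hu => ?_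
    rw [← norm_eq_zero, ← hnorm g hgS u]
    simpa using hu
  refine ⟨g, ⟨hinj, LinearMap.injective_iff_surjective.1 hinj⟩, hgS.2, ?_⟩
  -- The one-parameter groups of inner automorphisms stay in `S`.
  have hexp : ∀ (u : E) (s : ℝ), NormedSpace.exp (s • βc u) * g ∈ S := by
    intro u s
    have hder : ∀ (v : E) (s : ℝ), HasDerivAt (fun s : ℝ => NormedSpace.exp (s • βc u) v)
        (βc u (NormedSpace.exp (s • βc u) v)) s := by
      intro v s
      have := (hasDerivAt_exp_smul_const' (βc u) s).clm_apply (hasDerivAt_const s v)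
      simpa using this
    constructor
    · intro v w
      rw [← hgS.1 v w]
      have hd : ∀ s : ℝ, HasDerivAt (fun s : ℝ => ⟪NormedSpace.exp (s • βc u) (g v),
          NormedSpace.exp (s • βc u) (g w)⟫_ℝ) 0 s := by
        intro s
        convert! (hder (g v) s).inner ℝ (hder (g w) s) using 1
        rw [hβc, hβc, hinv]
        ring
      have := is_const_of_deriv_eq_zero (fun s => (hd s).differentiableAt)
        (fun s => (hd s).deriv) s 0
      simpa using this
    · intro v w
      have := eq_exp_apply_of_hasDerivAt (βc u) (fun s : ℝ =>
        βc (NormedSpace.exp (s • βc u) (g v)) (NormedSpace.exp (s • βc u) (g w))) (fun s => by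
          have h1 := (βc.hasFDerivAt.comp_hasDerivAt s (hder (g v) s)).clm_apply (hder (g w) s)
          convert! h1 using 1
          simp only [hβc]
          exact hjac _ _ _) s
      simp only [zero_smul, NormedSpace.exp_zero, one_apply_eq_self] at this
      rw [mul_apply_eq_comp, hgS.2, ← this]
      rfl
  have hcrit : ∀ u, ⟪u, β (g y) x⟫_ℝ = 0 := by
    intro u
    have hd : HasDerivAt (fun s : ℝ => ⟪NormedSpace.exp (s • βc u) (g y), x⟫_ℝ)
        ⟪βc u (g y), x⟫_ℝ 0 := by
      have h1 := ((hasDerivAt_exp_smul_const' (βc u) (0 : ℝ)).clm_apply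
        (hasDerivAt_const (0 : ℝ) (g y))).inner ℝ (hasDerivAt_const (0 : ℝ) x)
      simpa using h1
    have hloc : IsLocalMax (fun s : ℝ => ⟪NormedSpace.exp (s • βc u) (g y), x⟫_ℝ) 0 := by
      refine Filter.Eventually.of_forall fun s => ?_
      have := hmax (hexp u s)
      simpa using this
    have h0 := hloc.hasDerivAt_eq_zero hd
    rw [hβc, hanti, inner_neg_left, hinv, neg_neg] at h0
    exact h0
  exact inner_self_eq_zero.1 (hcrit _)

end Hunt

section Compact

variable {𝔤 : Type*} [LieRing 𝔤] [LieAlgebra ℝ 𝔤]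

/-! ### Centralizers and invariant inner products -/

theorem mem_cent {𝔥 : LieSubalgebra ℝ 𝔤} {x z : 𝔤} : z ∈ cent 𝔥 x ↔ z ∈ 𝔥 ∧ ⁅x, z⁆ = 0 := by
  simp only [cent, LieSubalgebra.mem_inf, and_congr_right_iff]
  intro _
  exact ⟨fun h => h x rfl, fun h s hs => by rw [Set.mem_singleton_iff.1 hs, h]⟩

theorem mem_centralizer {S : Set 𝔤} {z : 𝔤} : z ∈ centralizer S ↔ ∀ s ∈ S, ⁅s, z⁆ = 0 :=
  Iff.rfl

theorem mem_centerSub {𝔥 : LieSubalgebra ℝ 𝔤} {z : 𝔤} :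
    z ∈ centerSub 𝔥 ↔ z ∈ 𝔥 ∧ ∀ y ∈ 𝔥, ⁅y, z⁆ = 0 := by
  simp only [centerSub, Submodule.mem_map, LieSubmodule.mem_toSubmodule]
  constructor
  · rintro ⟨w, hw, rfl⟩
    exact ⟨w.2, fun y hy => congrArg Subtype.val (hw ⟨y, hy⟩)⟩
  · rintro ⟨hz, h⟩
    exact ⟨⟨z, hz⟩, fun y => Subtype.ext (h y y.2), rfl⟩

theorem lie_mem_semisimplePart {𝔥 : LieSubalgebra ℝ 𝔤} {u v : 𝔤} (hu : u ∈ 𝔥) (hv : v ∈ 𝔥) :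
    ⁅u, v⁆ ∈ semisimplePart 𝔥 :=
  ⟨⁅(⟨u, hu⟩ : 𝔥), (⟨v, hv⟩ : 𝔥)⁆, LieSubmodule.lie_mem_lie (LieSubmodule.mem_top _)
    (LieSubmodule.mem_top _), rfl⟩

theorem semisimplePart_le_iff {𝔥 : LieSubalgebra ℝ 𝔤} {N : Submodule ℝ 𝔤} :
    semisimplePart 𝔥 ≤ N ↔ ∀ u ∈ 𝔥, ∀ v ∈ 𝔥, ⁅u, v⁆ ∈ N := by
  refine ⟨fun h u hu v hv => h (lie_mem_semisimplePart hu hv), fun h => ?_⟩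
  rw [semisimplePart, Submodule.map_le_iff_le_comap, LieSubmodule.lieIdeal_oper_eq_linear_span,
    Submodule.span_le]
  rintro _ ⟨u, v, rfl⟩
  exact h _ u.1.2 _ v.1.2

theorem semisimplePart_le (𝔥 : LieSubalgebra ℝ 𝔤) : semisimplePart 𝔥 ≤ 𝔥.toSubmodule :=
  semisimplePart_le_iff.2 fun _ hu _ hv => 𝔥.lie_mem hu hv

theorem minCentDim_le (𝔥 : LieSubalgebra ℝ 𝔤) {𝔪 : Submodule ℝ 𝔤} {y : 𝔤} (hy : y ∈ 𝔪) :
    minCentDim 𝔥 𝔪 ≤ finrank ℝ (cent 𝔥 y) :=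
  Nat.sInf_le ⟨y, hy, rfl⟩

theorem le_minCentDim {𝔥 : LieSubalgebra ℝ 𝔤} {𝔪 : Submodule ℝ 𝔤} {n : ℕ}
    (h : ∀ y ∈ 𝔪, n ≤ finrank ℝ (cent 𝔥 y)) : n ≤ minCentDim 𝔥 𝔪 := by
  refine le_csInf ⟨_, 0, 𝔪.zero_mem, rfl⟩ ?_
  rintro _ ⟨y, hy, rfl⟩
  exact h y hy

theorem exists_finrank_cent_eq_minCentDim (𝔥 : LieSubalgebra ℝ 𝔤) (𝔪 : Submodule ℝ 𝔤) :
    ∃ y ∈ 𝔪, finrank ℝ (cent 𝔥 y) = minCentDim 𝔥 𝔪 :=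
  Nat.sInf_mem (s := {n : ℕ | ∃ y ∈ 𝔪, finrank ℝ (cent 𝔥 y) = n}) ⟨_, 0, 𝔪.zero_mem, rfl⟩

theorem finrank_cent_eq_finrank_ker (𝔥 : LieSubalgebra ℝ 𝔤) (x : 𝔤) :
    finrank ℝ (cent 𝔥 x) =
      finrank ℝ (LinearMap.ker ((LieAlgebra.ad ℝ 𝔤 x : 𝔤 →ₗ[ℝ] 𝔤) ∘ₗ 𝔥.toSubmodule.subtype)) := by
  rw [← Submodule.finrank_map_subtype_eq 𝔥.toSubmodule]
  have : (cent 𝔥 x).toSubmodule = (LinearMap.ker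
      ((LieAlgebra.ad ℝ 𝔤 x : 𝔤 →ₗ[ℝ] 𝔤) ∘ₗ 𝔥.toSubmodule.subtype)).map
        𝔥.toSubmodule.subtype := by
    ext z
    simp [mem_cent, and_comm]
  rw [← this]
  rfl

/-- If `𝔥^x` has minimal dimension along the line `x + ty`, then `[y, 𝔥^x] ⊆ [x, 𝔥]`. -/
theorem exists_lie_eq_of_finrank_cent_le [FiniteDimensional ℝ 𝔤] {𝔥 : LieSubalgebra ℝ 𝔤}
    {x y z : 𝔤} (h : ∀ t : ℝ, finrank ℝ (cent 𝔥 x) ≤ finrank ℝ (cent 𝔥 (x + t • y)))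
    (hz : z ∈ cent 𝔥 x) : ∃ w ∈ 𝔥, ⁅y, z⁆ = ⁅x, w⁆ := by
  have hz' := mem_cent.1 hz
  obtain ⟨w, hw⟩ := apply_mem_range_of_finrank_ker_le
    ((LieAlgebra.ad ℝ 𝔤 x : 𝔤 →ₗ[ℝ] 𝔤) ∘ₗ 𝔥.toSubmodule.subtype)
    ((LieAlgebra.ad ℝ 𝔤 y : 𝔤 →ₗ[ℝ] 𝔤) ∘ₗ 𝔥.toSubmodule.subtype) (fun t => by
      have := h t
      rw [finrank_cent_eq_finrank_ker, finrank_cent_eq_finrank_ker, map_add, map_smul] at this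
      exact this) (z := ⟨z, hz'.1⟩) hz'.2
  exact ⟨w, w.2, hw.symm⟩

theorem exists_lie_eq_of_minCentDim [FiniteDimensional ℝ 𝔤] {𝔥 : LieSubalgebra ℝ 𝔤}
    {𝔪 : Submodule ℝ 𝔤} {x y z : 𝔤} (hx : x ∈ 𝔪) (hy : y ∈ 𝔪)
    (h : finrank ℝ (cent 𝔥 x) = minCentDim 𝔥 𝔪) (hz : z ∈ cent 𝔥 x) :
    ∃ w ∈ 𝔥, ⁅y, z⁆ = ⁅x, w⁆ :=
  exists_lie_eq_of_finrank_cent_le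
    (fun t => h ▸ minCentDim_le 𝔥 (𝔪.add_mem hx (𝔪.smul_mem t hy))) hz

theorem finrank_cent_top_coe {𝔥 : LieSubalgebra ℝ 𝔤} (x : 𝔥) :
    finrank ℝ (cent (⊤ : LieSubalgebra ℝ 𝔥) x) = finrank ℝ (cent 𝔥 (x : 𝔤)) := by
  have : (cent (⊤ : LieSubalgebra ℝ 𝔥) x).toSubmodule.map 𝔥.toSubmodule.subtype =
      (cent 𝔥 (x : 𝔤)).toSubmodule := by
    ext z
    simp only [Submodule.mem_map, LieSubalgebra.mem_toSubmodule, mem_cent]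
    constructor
    · rintro ⟨w, ⟨-, hw⟩, rfl⟩
      exact ⟨w.2, congrArg Subtype.val hw⟩
    · rintro ⟨hz, h⟩
      exact ⟨⟨z, hz⟩, ⟨trivial, Subtype.ext h⟩, rfl⟩
  exact (Submodule.finrank_map_subtype_eq 𝔥.toSubmodule
    (cent (⊤ : LieSubalgebra ℝ 𝔥) x).toSubmodule).symm.trans (by rw [this]; rfl)

/-- The centralizer of `𝔥` and `[𝔥, 𝔥]` commute, so that their sum is a subalgebra. -/
theorem exists_subalgebra_eq_sup (𝔥 : LieSubalgebra ℝ 𝔤) :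
    ∃ 𝔩 : LieSubalgebra ℝ 𝔤,
      𝔩.toSubmodule = (centralizer (𝔥 : Set 𝔤)).toSubmodule ⊔ semisimplePart 𝔥 := by
  refine ⟨{ (centralizer (𝔥 : Set 𝔤)).toSubmodule ⊔ semisimplePart 𝔥 with
    lie_mem' := fun {x y} hx hy => ?_ }, rfl⟩
  obtain ⟨c, hc, s, hs, rfl⟩ := Submodule.mem_sup.1 hx
  obtain ⟨c', hc', s', hs', rfl⟩ := Submodule.mem_sup.1 hy
  have hsh := semisimplePart_le 𝔥 hs
  have hsh' := semisimplePart_le 𝔥 hs'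
  have h1 : ⁅s, c'⁆ = 0 := hc' s hsh
  have h2 : ⁅c, s'⁆ = 0 := by rw [← lie_skew, hc s' hsh', neg_zero]
  have : ⁅c + s, c' + s'⁆ = ⁅c, c'⁆ + ⁅s, s'⁆ := by
    rw [add_lie, lie_add, lie_add, h1, h2, add_zero, zero_add]
  change ⁅c + s, c' + s'⁆ ∈ (centralizer (𝔥 : Set 𝔤)).toSubmodule ⊔ semisimplePart 𝔥
  rw [this]
  exact Submodule.add_mem_sup ((centralizer (𝔥 : Set 𝔤)).lie_mem hc hc')
    (lie_mem_semisimplePart hsh hsh')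

namespace IsInvariantInner

variable {B : LinearMap.BilinForm ℝ 𝔤} (hB : IsInvariantInner B)

include hB

theorem comm (x y : 𝔤) : B x y = B y x := hB.1.eq x y

theorem apply_lie (x y z : 𝔤) : B ⁅x, y⁆ z = -B y ⁅x, z⁆ := hB.2.2 x y z

theorem eq_zero {x : 𝔤} (h : B x x = 0) : x = 0 := by
  by_contra hx
  exact (hB.2.1 x hx).ne' h

theorem restrict (𝔥 : LieSubalgebra ℝ 𝔤) : IsInvariantInner (𝔤 := 𝔥) (B.restrict 𝔥.toSubmodule) :=
  ⟨⟨fun x y => hB.comm x y⟩, fun x hx => hB.2.1 x fun h => hx (Subtype.ext h),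
    fun x y z => hB.apply_lie x y z⟩

theorem exists_add_orthogonal [FiniteDimensional ℝ 𝔤] (S : Submodule ℝ 𝔤) (w : 𝔤) :
    ∃ s ∈ S, ∃ t, (∀ u ∈ S, B u t = 0) ∧ w = s + t := by
  have hd : Disjoint S (B.orthogonal S) := by
    rw [Submodule.disjoint_def]
    exact fun x hx hx' => hB.eq_zero (hx' x hx)
  have hr : B.IsRefl := hB.1.isRefl
  have hc := LinearMap.BilinForm.isCompl_orthogonal_of_restrict_nondegenerate hr
    (B.nondegenerate_restrict_of_disjoint_orthogonal hr hd)
  obtain ⟨s, hs, t, ht, h⟩ := Submodule.mem_sup.1 (hc.sup_eq_top ▸ Submodule.mem_top (x := w))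
  exact ⟨s, hs, t, ht, h.symm⟩

/-- As `ad x` is skew, it has no nilpotent part. -/
theorem lie_eq_zero_of_lie_lie_eq_zero {x z : 𝔤} (h : ⁅x, ⁅x, z⁆⁆ = 0) : ⁅x, z⁆ = 0 :=
  hB.eq_zero (by rw [hB.apply_lie, h, map_zero, neg_zero])

theorem mem_engel_iff {x z : 𝔤} : z ∈ LieSubalgebra.engel ℝ x ↔ ⁅x, z⁆ = 0 := by
  rw [LieSubalgebra.mem_engel_iff]
  refine ⟨?_, fun h => ⟨1, by simpa using h⟩⟩
  rintro ⟨n, hn⟩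
  induction n with
  | zero =>
    simp only [pow_zero, Module.End.one_apply] at hn
    rw [hn, lie_zero]
  | succ n ih =>
    rcases n with _ | n
    · simpa using hn
    · refine ih ?_
      rw [pow_succ', Module.End.mul_apply, LieAlgebra.ad_apply] at hn ⊢
      rw [pow_succ', Module.End.mul_apply, LieAlgebra.ad_apply] at hn
      exact hB.lie_eq_zero_of_lie_lie_eq_zero hn

theorem engel_eq_cent (x : 𝔤) : LieSubalgebra.engel ℝ x = cent ⊤ x := by
  ext z
  simp [hB.mem_engel_iff, mem_cent]

/-! ### Regular elements and the rank -/

variable [FiniteDimensional ℝ 𝔤]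

/-- Hunt's theorem on the Lie algebra level: any element of a compact Lie algebra can be moved by an
automorphism to commute with a given one. -/
theorem exists_automorphism_lie_eq_zero (x y : 𝔤) :
    ∃ g : 𝔤 →ₗ[ℝ] 𝔤, Function.Bijective g ∧ (∀ u v, g ⁅u, v⁆ = ⁅g u, g v⁆) ∧ ⁅g y, x⁆ = 0 := by
  let core : InnerProductSpace.Core ℝ 𝔤 :=
    { inner := fun x y => B x y
      conj_inner_symm := fun x y => hB.comm y x
      re_inner_nonneg := fun x => by
        by_cases hx : x = 0
        · simp [hx]
        · exact (hB.2.1 x hx).le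
      add_left := fun x y z => by simp
      smul_left := fun x y c => by simp
      definite := fun x hx => hB.eq_zero hx }
  let : NormedAddCommGroup 𝔤 := core.toNormedAddCommGroup
  let : InnerProductSpace ℝ 𝔤 := InnerProductSpace.ofCore core.toCore
  exact exists_automorphism_apply_apply_eq_zero (E := 𝔤)
    (LieModule.toEnd ℝ 𝔤 𝔤 : 𝔤 →ₗ[ℝ] 𝔤 →ₗ[ℝ] 𝔤)
    (fun u v => (lie_skew u v).symm) (fun u v w => leibniz_lie u v w)
    (fun u v w => hB.apply_lie u v w) x y

/-- An element with abelian centralizer is regular: by Hunt's theorem a conjugate of any other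
element `y` lies in this centralizer, and is therefore centralized by it. -/
theorem finrank_cent_le_of_abelian {x : 𝔤}
    (hab : ∀ u ∈ cent ⊤ x, ∀ v ∈ cent ⊤ x, ⁅u, v⁆ = 0) (y : 𝔤) :
    finrank ℝ (cent ⊤ x) ≤ finrank ℝ (cent ⊤ y) := by
  obtain ⟨g, hg, hlie, h0⟩ := hB.exists_automorphism_lie_eq_zero x y
  have hgy : g y ∈ cent ⊤ x := mem_cent.2 ⟨trivial, by rw [← lie_skew, h0, neg_zero]⟩
  have hle : (cent ⊤ x).toSubmodule ≤ (cent ⊤ y).toSubmodule.map g := by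
    intro v hv
    obtain ⟨w, rfl⟩ := hg.2 v
    refine ⟨w, mem_cent.2 ⟨trivial, hg.1 ?_⟩, rfl⟩
    rw [hlie, map_zero]
    exact hab _ hgy _ hv
  exact (Submodule.finrank_mono hle).trans (Submodule.finrank_map_le _ _)

theorem finrank_cent_eq_rank {x : 𝔤}
    (hab : ∀ u ∈ cent ⊤ x, ∀ v ∈ cent ⊤ x, ⁅u, v⁆ = 0) :
    finrank ℝ (cent ⊤ x) = LieAlgebra.rank ℝ 𝔤 := by
  obtain ⟨y, hy⟩ := LieAlgebra.exists_isRegular ℝ 𝔤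
  rw [LieAlgebra.isRegular_iff_finrank_engel_eq_rank, hB.engel_eq_cent] at hy
  refine le_antisymm (hy ▸ hB.finrank_cent_le_of_abelian hab y) ?_
  rw [← hB.engel_eq_cent]
  exact LieAlgebra.rank_le_finrank_engel ℝ x

theorem finrank_cent_eq_rank_of_mem {𝔥 : LieSubalgebra ℝ 𝔤} {x : 𝔤} (hx : x ∈ 𝔥)
    (hab : ∀ u ∈ cent 𝔥 x, ∀ v ∈ cent 𝔥 x, ⁅u, v⁆ = 0) :
    finrank ℝ (cent 𝔥 x) = LieAlgebra.rank ℝ 𝔥 := by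
  rw [← (hB.restrict 𝔥).finrank_cent_eq_rank (x := ⟨x, hx⟩), finrank_cent_top_coe]
  intro u hu v hv
  exact Subtype.ext (hab u (mem_cent.2 ⟨u.2, congrArg Subtype.val (mem_cent.1 hu).2⟩)
    v (mem_cent.2 ⟨v.2, congrArg Subtype.val (mem_cent.1 hv).2⟩))

theorem rank_le_finrank_cent {𝔥 : LieSubalgebra ℝ 𝔤} {x : 𝔤} (hx : x ∈ 𝔥) :
    LieAlgebra.rank ℝ 𝔥 ≤ finrank ℝ (cent 𝔥 x) := by
  have := LieAlgebra.rank_le_finrank_engel ℝ (⟨x, hx⟩ : 𝔥)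
  rwa [(hB.restrict 𝔥).engel_eq_cent, finrank_cent_top_coe] at this

theorem isRegular_of_finrank_cent_eq {𝔥 : LieSubalgebra ℝ 𝔤} {x : 𝔤} (hx : x ∈ 𝔥)
    (h : finrank ℝ (cent 𝔥 x) = LieAlgebra.rank ℝ 𝔥) :
    LieAlgebra.IsRegular ℝ (⟨x, hx⟩ : 𝔥) := by
  rw [LieAlgebra.isRegular_iff_finrank_engel_eq_rank, (hB.restrict 𝔥).engel_eq_cent,
    finrank_cent_top_coe, h]

/-- For `v ∈ 𝔤^x` with `dim 𝔤^v` minimal, the centralizer `𝔤^v` is abelian and contained in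
`𝔤^x`. -/
theorem exists_abelian_cent_le (x : 𝔤) :
    ∃ v ∈ cent ⊤ x, cent ⊤ v ≤ cent ⊤ x ∧ ∀ u ∈ cent ⊤ v, ∀ w ∈ cent ⊤ v, ⁅u, w⁆ = 0 := by
  obtain ⟨v, hv, hmin⟩ := exists_finrank_cent_eq_minCentDim ⊤ (cent ⊤ x).toSubmodule
  have hxv : ⁅v, x⁆ = 0 := by rw [← lie_skew, (mem_cent.1 hv).2, neg_zero]
  have hle : ∀ z ∈ cent ⊤ v, ⁅x, z⁆ = 0 := by
    -- `[x, z]` lies in `[v, 𝔤]` by minimality, and in `𝔤^v` because `v` commutes with `x` and `z`.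
    intro z hz
    obtain ⟨w, -, hw⟩ := exists_lie_eq_of_minCentDim hv
      (mem_cent.2 ⟨trivial, lie_self x⟩ : x ∈ cent ⊤ x) hmin hz
    rw [hw]
    refine hB.lie_eq_zero_of_lie_lie_eq_zero ?_
    rw [← hw, leibniz_lie, hxv, (mem_cent.1 hz).2, zero_lie, lie_zero, add_zero]
  refine ⟨v, hv, fun z hz => mem_cent.2 ⟨trivial, hle z hz⟩, fun u hu w hw => ?_⟩
  -- `𝔤^v` is orthogonal to `[y, 𝔤^v] ⊆ [v, 𝔤]` for every `y` in `𝔤^x`; take `y = [u, w]`.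
  have hy : ⁅u, w⁆ ∈ cent ⊤ x := mem_cent.2 ⟨trivial, by
    rw [leibniz_lie, hle u hu, hle w hw, zero_lie, lie_zero, add_zero]⟩
  obtain ⟨t, -, ht⟩ := exists_lie_eq_of_minCentDim hv hy hmin hu
  refine hB.eq_zero ?_
  rw [hB.apply_lie, ← lie_skew, ht, map_neg, neg_neg, ← neg_neg (B w _), ← hB.apply_lie,
    (mem_cent.1 hw).2, map_zero, LinearMap.zero_apply, neg_zero]

/-- A subalgebra containing the centralizer of some element has maximal rank. -/
theorem rank_eq_of_cent_le {x : 𝔤} {𝔥 : LieSubalgebra ℝ 𝔤} (h : cent ⊤ x ≤ 𝔥) :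
    LieAlgebra.rank ℝ 𝔥 = LieAlgebra.rank ℝ 𝔤 := by
  obtain ⟨v, hv, hle, hab⟩ := hB.exists_abelian_cent_le x
  have hcent : cent 𝔥 v = cent ⊤ v := by
    ext z
    exact ⟨fun hz => mem_cent.2 ⟨trivial, (mem_cent.1 hz).2⟩,
      fun hz => mem_cent.2 ⟨h (hle hz), (mem_cent.1 hz).2⟩⟩
  rw [← hB.finrank_cent_eq_rank hab, ← hcent,
    hB.finrank_cent_eq_rank_of_mem (h hv) (hcent ▸ hab)]

/-! ### Splitting off the semisimple part -/

omit [FiniteDimensional ℝ 𝔤] in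
/-- The centralizer of `𝔥` is orthogonal to `[𝔥, 𝔥]`. -/
theorem disjoint_centralizer_semisimplePart (𝔥 : LieSubalgebra ℝ 𝔤) :
    Disjoint (centralizer (𝔥 : Set 𝔤)).toSubmodule (semisimplePart 𝔥) := by
  rw [Submodule.disjoint_def]
  intro w hw hws
  have : semisimplePart 𝔥 ≤ LinearMap.ker (B w) := semisimplePart_le_iff.2 fun u hu v hv => by
    rw [LinearMap.mem_ker, ← neg_neg (B w _), ← hB.apply_lie, mem_centralizer.1 hw u hu, map_zero,
      LinearMap.zero_apply, neg_zero]
  exact hB.eq_zero (this hws)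

/-- If `𝔩` contains and normalizes `𝔥`, then `𝔩` is the sum of the centralizer of `𝔥` in `𝔩` and of
`[𝔥, 𝔥]`: the orthogonal complement of `[𝔥, 𝔥]` in `𝔩` centralizes `𝔥`. -/
theorem toSubmodule_eq_sup_semisimplePart {𝔥 𝔩 : LieSubalgebra ℝ 𝔤} (hle : 𝔥 ≤ 𝔩)
    (hnorm : ∀ u ∈ 𝔩, ∀ v ∈ 𝔥, ⁅u, v⁆ ∈ 𝔥) :
    𝔩.toSubmodule = (𝔩 ⊓ centralizer (𝔥 : Set 𝔤)).toSubmodule ⊔ semisimplePart 𝔥 := by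
  refine le_antisymm (fun w hw => ?_)
    (sup_le (fun z hz => hz.1) ((semisimplePart_le 𝔥).trans hle))
  obtain ⟨s, hs, t, ht, rfl⟩ := hB.exists_add_orthogonal (semisimplePart 𝔥) w
  have htl : t ∈ 𝔩 := by
    simpa using 𝔩.sub_mem hw (hle (semisimplePart_le 𝔥 hs))
  refine Submodule.add_mem _ (Submodule.mem_sup_right hs)
    (Submodule.mem_sup_left ⟨htl, fun v hv => ?_⟩)
  have hvt : ⁅v, t⁆ ∈ 𝔥 := by
    rw [← lie_skew]
    exact 𝔥.neg_mem (hnorm t htl v hv)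
  refine hB.eq_zero ?_
  rw [hB.apply_lie, hB.comm, ht _ (lie_mem_semisimplePart hv hvt), neg_zero]

theorem finrank_eq_add_finrank_semisimplePart {𝔥 𝔩 : LieSubalgebra ℝ 𝔤} (hle : 𝔥 ≤ 𝔩)
    (hnorm : ∀ u ∈ 𝔩, ∀ v ∈ 𝔥, ⁅u, v⁆ ∈ 𝔥) :
    finrank ℝ 𝔩 = finrank ℝ ↥(𝔩 ⊓ centralizer (𝔥 : Set 𝔤)) + finrank ℝ (semisimplePart 𝔥) := by
  have hd : (𝔩 ⊓ centralizer (𝔥 : Set 𝔤)).toSubmodule ⊓ semisimplePart 𝔥 = ⊥ :=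
    ((hB.disjoint_centralizer_semisimplePart 𝔥).mono_left fun z hz => hz.2).eq_bot
  have := Submodule.finrank_sup_add_finrank_inf_eq
    (𝔩 ⊓ centralizer (𝔥 : Set 𝔤)).toSubmodule (semisimplePart 𝔥)
  rw [hd, finrank_bot, add_zero, ← hB.toSubmodule_eq_sup_semisimplePart hle hnorm] at this
  exact this

/-! ### Generic elements of the orthogonal complement -/

omit [FiniteDimensional ℝ 𝔤] in
theorem mem_cent_of_orthogonal {a w : 𝔤}
    (h : ∀ y ∈ B.orthogonal (cent ⊤ a).toSubmodule, B w y = 0) : w ∈ cent ⊤ a := by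
  refine mem_cent.2 ⟨trivial, hB.eq_zero ?_⟩
  rw [hB.apply_lie, h, neg_zero]
  intro n hn
  rw [← neg_neg (B n _), ← hB.apply_lie, (mem_cent.1 hn).2, map_zero, LinearMap.zero_apply,
    neg_zero]

/-- If `dim 𝔤^x` is minimal on `𝔪`, then `[𝔤^x, 𝔤^x]` is orthogonal to `𝔪`. -/
theorem apply_lie_eq_zero_of_minCentDim {𝔪 : Submodule ℝ 𝔤} {x y u v : 𝔤} (hx : x ∈ 𝔪)
    (hmin : finrank ℝ (cent ⊤ x) = minCentDim ⊤ 𝔪) (hu : u ∈ cent ⊤ x) (hv : v ∈ cent ⊤ x)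
    (hy : y ∈ 𝔪) : B ⁅u, v⁆ y = 0 := by
  obtain ⟨w, -, hw⟩ := exists_lie_eq_of_minCentDim hx hy hmin hu
  rw [hB.apply_lie, ← lie_skew, hw, map_neg, neg_neg, ← neg_neg (B v _), ← hB.apply_lie,
    (mem_cent.1 hv).2, map_zero, LinearMap.zero_apply, neg_zero]

/-- If `dim 𝔨^x` is minimal on `𝔪 = 𝔨^⊥`, then `𝔪(x)` commutes with `𝔨^x`. -/
theorem lie_eq_zero_of_mem_mAt {𝔨 : LieSubalgebra ℝ 𝔤} {x y z : 𝔤}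
    (hx : x ∈ B.orthogonal 𝔨.toSubmodule)
    (hmin : finrank ℝ (cent 𝔨 x) = minCentDim 𝔨 (B.orthogonal 𝔨.toSubmodule))
    (hy : y ∈ mAt (B.orthogonal 𝔨.toSubmodule) x) (hz : z ∈ cent 𝔨 x) : ⁅z, y⁆ = 0 := by
  obtain ⟨w, hwk, hw⟩ := exists_lie_eq_of_minCentDim hx hy.1 hmin hz
  have hzx : ⁅z, x⁆ = 0 := by rw [← lie_skew, (mem_cent.1 hz).2, neg_zero]
  refine hB.eq_zero ?_
  -- `[z, [z, y]]` lies in `[x, 𝔨]`, which is orthogonal to `y` because `[x, y] ∈ 𝔪`.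
  have h1 : ⁅z, ⁅z, y⁆⁆ = -⁅x, ⁅z, w⁆⁆ := by
    rw [← lie_skew z y, hw, lie_neg, leibniz_lie, hzx, zero_lie, zero_add]
  have h2 : B ⁅z, w⁆ ⁅x, y⁆ = 0 := hy.2 _ (𝔨.lie_mem (mem_cent.1 hz).1 hwk)
  rw [hB.apply_lie, h1, map_neg, neg_neg, ← neg_neg (B y _), ← hB.apply_lie, hB.comm, h2, neg_zero]

end IsInvariantInner

end Compact

end CompactPair

/-! ### The reduction to the centralizer of `𝔨^{x₀}` -/

open CompactPair in
theorem proposition2p1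
    {𝔤 : Type*} [LieRing 𝔤] [LieAlgebra ℝ 𝔤] [FiniteDimensional ℝ 𝔤]
    (B : LinearMap.BilinForm ℝ 𝔤) (hB : IsInvariantInner B)
    (a : 𝔤) (𝔨 : LieSubalgebra ℝ 𝔤) (h𝔨 : 𝔨 = cent ⊤ a)
    (𝔪 : Submodule ℝ 𝔤) (h𝔪 : 𝔪 = B.orthogonal 𝔨.toSubmodule)
    (x₀ : 𝔤) (hx₀ : x₀ ∈ R ⊤ 𝔨 𝔪)
    (𝔤₀ : LieSubalgebra ℝ 𝔤) (h𝔤₀ : 𝔤₀ = centralizer (cent 𝔨 x₀ : Set 𝔤))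
    (𝔨₀ : LieSubalgebra ℝ 𝔤) (h𝔨₀ : 𝔨₀ = 𝔨 ⊓ centralizer (cent 𝔨 x₀ : Set 𝔤))
    (𝔪₀ : Submodule ℝ 𝔤) (h𝔪₀ : 𝔪₀ = 𝔤₀.toSubmodule ⊓ 𝔪) :
    -- equality of `𝔪₀(x)` and `𝔪(x)`
    (x₀ ∈ 𝔪₀ ∧ ∀ x ∈ 𝔪₀, x ∈ R ⊤ 𝔨 𝔪 → mAt 𝔪₀ x = mAt 𝔪 x) ∧
    -- constancy of `𝔨^x`, and `𝔪₀ ∩ R(𝔪) ⊆ R(𝔪₀)`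
    (∀ x ∈ 𝔪₀, x ∈ R ⊤ 𝔨 𝔪 → cent 𝔨 x = cent 𝔨 x₀ ∧ x ∈ R 𝔤₀ 𝔨₀ 𝔪₀) ∧
    -- the decomposition of `𝔤^{x₀}` and the subalgebra of maximal rank
    (a ∈ 𝔤₀ ∧
      (Disjoint (cent 𝔤₀ x₀).toSubmodule (semisimplePart (cent 𝔨 x₀)) ∧
        (cent ⊤ x₀).toSubmodule = (cent 𝔤₀ x₀).toSubmodule ⊔ semisimplePart (cent 𝔨 x₀)) ∧
      Disjoint 𝔤₀.toSubmodule (semisimplePart (cent 𝔨 x₀)) ∧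
      ∃ 𝔥 : LieSubalgebra ℝ 𝔤,
        𝔥.toSubmodule = 𝔤₀.toSubmodule ⊔ semisimplePart (cent 𝔨 x₀) ∧
        LieAlgebra.rank ℝ 𝔥 = LieAlgebra.rank ℝ 𝔤) ∧
    -- regularity of the points of `R(𝔪₀)`, and their centralizers in `𝔨₀`
    (∀ x ∈ R 𝔤₀ 𝔨₀ 𝔪₀,
      (∃ hx : x ∈ 𝔤₀, LieAlgebra.IsRegular ℝ (⟨x, hx⟩ : 𝔤₀)) ∧
      (cent 𝔨₀ x).toSubmodule = centerSub 𝔤₀) ∧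
    -- the value of `r(𝔪)`
    (r ⊤ 𝔨 𝔪 = r 𝔤₀ 𝔨₀ 𝔪₀ ∧
      r ⊤ 𝔨 𝔪 =
        (LieAlgebra.rank ℝ 𝔤₀ : ℤ) - (Module.finrank ℝ (LieAlgebra.center ℝ 𝔤₀) : ℤ)) := by
  have hcomm : ∀ {x y : 𝔤}, ⁅x, y⁆ = 0 → ⁅y, x⁆ = 0 := fun h => by
    rw [← lie_skew, h, neg_zero]
  have mem_𝔤₀ : ∀ {z : 𝔤}, z ∈ 𝔤₀ ↔ ∀ s ∈ cent 𝔨 x₀, ⁅s, z⁆ = 0 := by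
    subst h𝔤₀
    exact Iff.rfl
  have h𝔨₀' : 𝔨₀ = 𝔨 ⊓ 𝔤₀ := by rw [h𝔨₀, h𝔤₀]
  have mem_𝔨₀ : ∀ {z : 𝔤}, z ∈ 𝔨₀ ↔ z ∈ 𝔨 ∧ z ∈ 𝔤₀ := by
    rw [h𝔨₀']
    exact LieSubalgebra.mem_inf _ _ _
  have mem_𝔪₀ : ∀ {z : 𝔤}, z ∈ 𝔪₀ ↔ z ∈ 𝔤₀ ∧ z ∈ 𝔪 := by
    rw [h𝔪₀]
    exact Submodule.mem_inf
  have mem_𝔨 : ∀ {z : 𝔤}, z ∈ 𝔨 ↔ ⁅a, z⁆ = 0 := by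
    rw [h𝔨]
    exact mem_cent.trans (and_iff_right trivial)
  have ha : a ∈ 𝔤₀ := mem_𝔤₀.2 fun s hs => hcomm (mem_𝔨.1 (mem_cent.1 hs).1)
  have hx₀𝔤₀ : x₀ ∈ 𝔤₀ := mem_𝔤₀.2 fun s hs => hcomm (mem_cent.1 hs).2
  have hx₀𝔪₀ : x₀ ∈ 𝔪₀ := mem_𝔪₀.2 ⟨hx₀𝔤₀, hx₀.1⟩
  have hle : ∀ x ∈ 𝔤₀, cent 𝔨 x₀ ≤ cent 𝔨 x := fun x hx z hz =>
    mem_cent.2 ⟨(mem_cent.1 hz).1, hcomm (mem_𝔤₀.1 hx z hz)⟩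
  have hcent : ∀ x ∈ 𝔪₀, x ∈ R ⊤ 𝔨 𝔪 → cent 𝔨 x = cent 𝔨 x₀ := fun x hx hxR => by
    refine LieSubalgebra.toSubmodule_injective
      (Submodule.eq_of_le_of_finrank_eq (hle x (mem_𝔪₀.1 hx).1) ?_).symm
    exact hx₀.2.2.trans hxR.2.2.symm
  -- `𝔨₀^x` is the center of `𝔤₀` as soon as `𝔨^x = 𝔨^{x₀}`.
  have hcenter : ∀ x ∈ 𝔤₀, cent 𝔨 x = cent 𝔨 x₀ →
      (cent 𝔨₀ x).toSubmodule = centerSub 𝔤₀ := by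
    intro x hx hxx
    ext z
    rw [mem_centerSub, LieSubalgebra.mem_toSubmodule, mem_cent, mem_𝔨₀]
    constructor
    · rintro ⟨⟨hzk, hz⟩, hxz⟩
      exact ⟨hz, fun y hy => hcomm (mem_𝔤₀.1 hy z (hxx ▸ mem_cent.2 ⟨hzk, hxz⟩))⟩
    · rintro ⟨hz, h⟩
      exact ⟨⟨mem_𝔨.2 (h a ha), hz⟩, h x hx⟩
  have hcenter_le : ∀ x ∈ 𝔤₀, centerSub 𝔤₀ ≤ (cent 𝔨₀ x).toSubmodule := by
    intro x hx z hz
    rw [mem_centerSub] at hz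
    exact mem_cent.2 ⟨mem_𝔨₀.2 ⟨mem_𝔨.2 (hz.2 a ha), hz.1⟩, hz.2 x hx⟩
  -- `[𝔤^x, 𝔤^x] ⊆ 𝔨^x` for `x` in `R(𝔪)`.
  have hderived : ∀ x ∈ R ⊤ 𝔨 𝔪, ∀ u ∈ cent ⊤ x, ∀ v ∈ cent ⊤ x, ⁅u, v⁆ ∈ cent 𝔨 x := by
    intro x hx u hu v hv
    refine mem_cent.2 ⟨?_, (mem_cent.1 ((cent ⊤ x).lie_mem hu hv)).2⟩
    rw [h𝔨]
    refine hB.mem_cent_of_orthogonal fun y hy => ?_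
    exact hB.apply_lie_eq_zero_of_minCentDim hx.1 hx.2.1 hu hv (by rwa [h𝔪, h𝔨])
  -- `[u, v]` lies in `𝔨^{x₀}` and so commutes with `u ∈ 𝔤₀`; since `ad u` is skew, it vanishes.
  have habelian : ∀ x ∈ 𝔪₀, x ∈ R ⊤ 𝔨 𝔪 → ∀ u ∈ cent 𝔤₀ x, ∀ v ∈ cent 𝔤₀ x, ⁅u, v⁆ = 0 := by
    intro x hx hxR u hu v hv
    have hu' := mem_cent.1 hu
    have hv' := mem_cent.1 hv
    have huv : ⁅u, v⁆ ∈ cent 𝔨 x :=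
      hderived x hxR u (mem_cent.2 ⟨trivial, hu'.2⟩) v (mem_cent.2 ⟨trivial, hv'.2⟩)
    have h0 : ⁅u, ⁅u, v⁆⁆ = 0 := hcomm (mem_𝔤₀.1 hu'.1 _ (hcent x hx hxR ▸ huv))
    exact hB.lie_eq_zero_of_lie_lie_eq_zero h0
  have hrank : ∀ x ∈ 𝔪₀, x ∈ R ⊤ 𝔨 𝔪 →
      Module.finrank ℝ (cent 𝔤₀ x) = LieAlgebra.rank ℝ 𝔤₀ := fun x hx hxR =>
    hB.finrank_cent_eq_rank_of_mem (mem_𝔪₀.1 hx).1 (habelian x hx hxR)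
  have hq₀ : minCentDim 𝔤₀ 𝔪₀ = LieAlgebra.rank ℝ 𝔤₀ :=
    le_antisymm (hrank x₀ hx₀𝔪₀ hx₀ ▸ minCentDim_le 𝔤₀ hx₀𝔪₀)
      (le_minCentDim fun y hy => hB.rank_le_finrank_cent (mem_𝔪₀.1 hy).1)
  have hp₀ : minCentDim 𝔨₀ 𝔪₀ = Module.finrank ℝ (centerSub 𝔤₀) := by
    refine le_antisymm ?_ (le_minCentDim fun y hy =>
      Submodule.finrank_mono (hcenter_le y (mem_𝔪₀.1 hy).1))
    rw [← hcenter x₀ hx₀𝔤₀ rfl]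
    exact minCentDim_le 𝔨₀ hx₀𝔪₀
  have hinf : cent ⊤ x₀ ⊓ centralizer (cent 𝔨 x₀ : Set 𝔤) = cent 𝔤₀ x₀ := by
    ext z
    simp only [LieSubalgebra.mem_inf, mem_cent, h𝔤₀]
    exact ⟨fun h => ⟨h.2, h.1.2⟩, fun h => ⟨⟨trivial, h.2⟩, h.1⟩⟩
  have hinf' : cent 𝔨 x₀ ⊓ centralizer (cent 𝔨 x₀ : Set 𝔤) = cent 𝔨₀ x₀ := by
    ext z
    simp only [LieSubalgebra.mem_inf, mem_cent, h𝔨₀]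
    exact ⟨fun h => ⟨⟨h.1.1, h.2⟩, h.1.2⟩, fun h => ⟨⟨h.1.1, h.2⟩, h.1.2⟩⟩
  have hsub : cent 𝔨 x₀ ≤ cent ⊤ x₀ := fun z hz => mem_cent.2 ⟨trivial, (mem_cent.1 hz).2⟩
  have hnorm : ∀ u ∈ cent ⊤ x₀, ∀ v ∈ cent 𝔨 x₀, ⁅u, v⁆ ∈ cent 𝔨 x₀ := fun u hu v hv =>
    hderived x₀ hx₀ u hu v (hsub hv)
  have hsum := hB.toSubmodule_eq_sup_semisimplePart hsub hnorm
  rw [hinf] at hsum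
  have hdisj : Disjoint 𝔤₀.toSubmodule (semisimplePart (cent 𝔨 x₀)) :=
    h𝔤₀ ▸ hB.disjoint_centralizer_semisimplePart (cent 𝔨 x₀)
  have hr : r ⊤ 𝔨 𝔪 = r 𝔤₀ 𝔨₀ 𝔪₀ := by
    have hq := hB.finrank_eq_add_finrank_semisimplePart hsub hnorm
    have hp := hB.finrank_eq_add_finrank_semisimplePart (le_refl (cent 𝔨 x₀))
      fun u hu v hv => (cent 𝔨 x₀).lie_mem hu hv
    have hz : Module.finrank ℝ (cent 𝔨₀ x₀) = Module.finrank ℝ (centerSub 𝔤₀) := by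
      rw [← hcenter x₀ hx₀𝔤₀ rfl]
      rfl
    rw [hinf, hx₀.2.1, hrank x₀ hx₀𝔪₀ hx₀] at hq
    rw [hinf', hx₀.2.2, hz] at hp
    rw [r, r, hq, hp, hq₀, hp₀]
    push_cast
    ring
  refine ⟨⟨hx₀𝔪₀, fun x hx hxR => ?_⟩, fun x hx hxR => ⟨hcent x hx hxR, hx, ?_, ?_⟩,
    ⟨ha, ⟨hdisj.mono_left fun z hz => hz.1, hsum⟩, hdisj, ?_⟩, fun x hx => ?_, hr, ?_⟩
  · refine le_antisymm (fun y hy => ⟨(mem_𝔪₀.1 hy.1).2, (mem_𝔪₀.1 hy.2).2⟩) fun y hy => ?_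
    have hy₀ : y ∈ 𝔤₀ := mem_𝔤₀.2 fun s hs => by
      subst h𝔪
      exact hB.lie_eq_zero_of_mem_mAt hxR.1 hxR.2.2 hy (hcent x hx hxR ▸ hs)
    exact ⟨mem_𝔪₀.2 ⟨hy₀, hy.1⟩, mem_𝔪₀.2 ⟨𝔤₀.lie_mem (mem_𝔪₀.1 hx).1 hy₀, hy.2⟩⟩
  · rw [hq₀, hrank x hx hxR]
  · rw [hp₀, ← hcenter x (mem_𝔪₀.1 hx).1 (hcent x hx hxR)]
    rfl
  · obtain ⟨𝔥, h𝔥⟩ := exists_subalgebra_eq_sup (cent 𝔨 x₀)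
    rw [← h𝔤₀] at h𝔥
    refine ⟨𝔥, h𝔥, hB.rank_eq_of_cent_le (x := x₀) ?_⟩
    rw [← LieSubalgebra.toSubmodule_le_toSubmodule, h𝔥, hsum]
    exact sup_le_sup_right (fun z hz => hz.1) _
  · have hx𝔤₀ := (mem_𝔪₀.1 hx.1).1
    refine ⟨⟨hx𝔤₀, hB.isRegular_of_finrank_cent_eq hx𝔤₀ (hx.2.1.trans hq₀)⟩, ?_⟩
    exact (Submodule.eq_of_le_of_finrank_eq (hcenter_le x hx𝔤₀)
      (hp₀.symm.trans hx.2.2.symm)).symm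
  · rw [hr, r, hq₀, hp₀]
    congr 2
    exact Submodule.finrank_map_subtype_eq 𝔤₀.toSubmodule (LieAlgebra.center ℝ 𝔤₀).toSubmodule
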